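/- **Setting.** Let $n\ge 0$ and let $\mathfrak h$ be a complex vector space with basis $\beta^1,\dots,\beta^n,\alpha^1,\dots,\alpha^n$ and the symmetric bilinear form for which this basis is orthonormal. Let $M(1)=S(\mathfrak h\otimes t^{-1}\mathbb C[t^{-1}])$ be the Heisenberg vertex operator algebra of $\mathfrak h$: the operators $h(m)$ ($h\in\mathfrak h$, $m\in\mathbb Z$) on $M(1)$ satisfy $[h(m),h'(l)]=(h,h')\,m\,\delta_{m+l,0}$, $h(m)\mathbf 1=0$ for $m\ge 0$, $h(m)$ is multiplication by $h\otimes t^{m}$ for $m<0$, and for $v=h_1(-n_1)\cdots h_r(-n_r)\mathbf 1$ with $n_1,\dots,n_r\ge 1$ $$Y(v,z)=\sum_{m\in\mathbb Z}v_m z^{-m-1}={}^{\circ}_{\circ}\prod_{e=1}^r\frac{1}{(n_e-1)!}\Big(\frac{d}{dz}\Big)^{n_e-1}h_e(z){}^{\circ}_{\circ},\qquad h(z)=\sum_{m\in\mathbb Z}h(m)z^{-m-1},$$ where ${}^{\circ}_{\circ}\cdots{}^{\circ}_{\circ}$ places the operators $h(m)$ with $m<0$ to the left of those with $m\ge0$.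 Identify $h\in\mathfrak h$ with $h(-1)\mathbf 1\in M(1)$. **Definitions.** For a vertex algebra $V$ let $C_2(V)=\operatorname{span}_{\mathbb C}\{u_{-2}v: u,v\in V\}$. For a subspace $M\subseteq V$ let $r_{0,-1}(M)$ be the set of all $v\in V$ for which there is $m\ge0$ such that $v_{n_1}\cdots v_{n_t}v\in M$ for all $t\ge m$ and $n_1,\dots,n_t\in\{0,-1\}$. Let $sr_{0,-1}(M)$ be the set of all $v\in V$ such that for every $b\in V$ there is $m\ge0$ with $b_s(v_{n_1}\cdots v_{n_t}v)\in M$ and $(v_{n_1}\cdots v_{n_t}v)_s b\in M$ for all $t\ge m$ and $s,n_1,\dots,n_t\in\{0,-1\}$. The subspace $M$ is an *$MZ_{0,-1}$-subspace* of $V$ if $r_{0,-1}(M)=sr_{0,-1}(M)$. For a subspace $U$ of an associative unital algebra $A$ let $r(U)$ be the set of all $a\in A$ with $a^t\in U$ for all sufficiently large $t$, and $sr(U)$ the set of all $a\in A$ such that for all $b,c\in A$ one has $b\,a^t c\in U$ for all sufficiently large $t$; $U$ is a *Mathieu–Zhao subspace* of $A$ if $r(U)=sr(U)$. **Theorem.**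 For $1\le i\le n$ let $f_i:M(1)\to M(1)$ be the linear map $f_i(a)=\beta^i_1a-\alpha^i_{-1}a$. Let $0\le k\le n$. Then $$\sum_{i=1}^k f_i(M(1))+C_2(M(1))$$ is an $MZ_{0,-1}$-subspace of $M(1)$ if and only if $$\sum_{i=1}^k(\partial_{x_i}-\zeta_i)\,\mathbb C[\zeta_1,\dots,\zeta_n,x_1,\dots,x_n]$$ is a Mathieu–Zhao subspace of $\mathbb C[\zeta_1,\dots,\zeta_n,x_1,\dots,x_n]$. -/

import Mathlib

noncomputable section

/-! ### Mathieu–Zhao subspaces of associative algebras -/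

namespace MathieuZhao

variable {R A : Type*} [CommRing R] [Ring A] [Algebra R A]

/-- `r(U)`: all `a` such that `a ^ t ∈ U` for all sufficiently large `t`. -/
def radical (U : Submodule R A) : Set A :=
  {a | ∃ m : ℕ, 1 ≤ m ∧ ∀ t : ℕ, m ≤ t → a ^ t ∈ U}

/-- `sr(U)`: all `a` such that, for all `b, c`, `b * a ^ t * c ∈ U` for all sufficiently
large `t`. -/
def strongRadical (U : Submodule R A) : Set A :=
  {a | ∀ b c : A, ∃ m : ℕ, 1 ≤ m ∧ ∀ t : ℕ, m ≤ t → b * a ^ t * c ∈ U}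

/-- Mathieu–Zhao subspaces of an associative algebra. -/
def IsMZ (U : Submodule R A) : Prop :=
  radical U = strongRadical U

end MathieuZhao

/-! ### Notions attached to a state-field correspondence `Y`

These notions only involve the products `u_n v` on a vertex algebra `(V, Y, 𝟏)`. -/

namespace VOA

variable {V : Type*} [AddCommGroup V] [Module ℂ V]

/-- The mode `u_n`, where `Y(u, z) = ∑ u_n z ^ (-n-1)`. -/
def mode (Y : V →ₗ[ℂ] VertexOperator ℂ V) (u : V) (n : ℤ) : Module.End ℂ V :=
  VertexOperator.ncoeff (Y u) n

/-- `C₂(V)`, the span of all `u_{-2} v`. -/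
def C2 (Y : V →ₗ[ℂ] VertexOperator ℂ V) : Submodule ℂ V :=
  Submodule.span ℂ {x | ∃ u v : V, x = mode Y u (-2) v}

/-- `v_{n₁} v_{n₂} ⋯ v_{n_t} v` for the list `[n₁, …, n_t]`. -/
def iterProd (Y : V →ₗ[ℂ] VertexOperator ℂ V) (v : V) (ns : List ℤ) : V :=
  ns.foldr (fun n w => mode Y v n w) v

/-- A word in the letters `0` and `-1`. -/
def IsWord (ns : List ℤ) : Prop :=
  ∀ n ∈ ns, n = 0 ∨ n = -1

/-- `r_{0,-1}(M)`. -/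
def radical (Y : V →ₗ[ℂ] VertexOperator ℂ V) (M : Submodule ℂ V) : Set V :=
  {v | ∃ m : ℕ, ∀ ns : List ℤ, m ≤ ns.length → IsWord ns → iterProd Y v ns ∈ M}

/-- `lsr_{0,-1}(M)`. -/
def leftStrongRadical (Y : V →ₗ[ℂ] VertexOperator ℂ V) (M : Submodule ℂ V) : Set V :=
  {v | ∀ b : V, ∃ m : ℕ, ∀ ns : List ℤ, m ≤ ns.length → IsWord ns →
    ∀ s : ℤ, s = 0 ∨ s = -1 → mode Y b s (iterProd Y v ns) ∈ M}

/-- `rsr_{0,-1}(M)`. -/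
def rightStrongRadical (Y : V →ₗ[ℂ] VertexOperator ℂ V) (M : Submodule ℂ V) : Set V :=
  {v | ∀ w : V, ∃ m : ℕ, ∀ ns : List ℤ, m ≤ ns.length → IsWord ns →
    ∀ s : ℤ, s = 0 ∨ s = -1 → mode Y (iterProd Y v ns) s w ∈ M}

/-- `sr_{0,-1}(M)`. -/
def strongRadical (Y : V →ₗ[ℂ] VertexOperator ℂ V) (M : Submodule ℂ V) : Set V :=
  leftStrongRadical Y M ∩ rightStrongRadical Y M

/-- `M` is an `MZ_{0,-1}`-subspace. -/
def IsMZ (Y : V →ₗ[ℂ] VertexOperator ℂ V) (M : Submodule ℂ V) : Prop :=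
  radical Y M = strongRadical Y M

end VOA

/-! ### The Heisenberg vertex operator algebra -/

namespace Heisenberg

variable {ι : Type*}

/-- The underlying space `M(1) = S(𝔥 ⊗ t⁻¹ℂ[t⁻¹])` of the Heisenberg vertex operator algebra
of a complex space `𝔥` with a symmetric bilinear form and an orthonormal basis `(h_i)`, `i ∈ ι`.
The variable `X (i, m)` is `h_i(-m-1) 𝟏`, and the vacuum `𝟏` is the polynomial `1`. -/
abbrev Fock (ι : Type*) : Type _ := MvPolynomial (ι × ℕ) ℂ

/-- The operator `h_i(n) = h_i ⊗ tⁿ` on `M(1)` (the central element acts as `1`):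
multiplication by `h_i(n) 𝟏` for `n < 0`, and `n ∂/∂(h_i(-n) 𝟏)` for `n ≥ 0`
(so `h_i(0) = 0`). -/
def osc (i : ι) (n : ℤ) : Module.End ℂ (Fock ι) :=
  if n < 0 then LinearMap.mulLeft ℂ (MvPolynomial.X (i, (-n - 1).toNat))
  else (n : ℂ) • (MvPolynomial.pderiv (i, (n - 1).toNat)).toLinearMap

theorem pderiv_comm (a b : ι × ℕ) (w : Fock ι) :
    MvPolynomial.pderiv a (MvPolynomial.pderiv b w) =
      MvPolynomial.pderiv b (MvPolynomial.pderiv a w) := by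
  classical
  have h : ⁅(MvPolynomial.pderiv a : Derivation ℂ (Fock ι) (Fock ι)),
      (MvPolynomial.pderiv b : Derivation ℂ (Fock ι) (Fock ι))⁆ = 0 := by
    apply MvPolynomial.derivation_ext
    intro c
    simp [Derivation.commutator_apply, MvPolynomial.pderiv_X, Pi.single_apply, apply_ite]
  have := congrArg (fun D : Derivation ℂ (Fock ι) (Fock ι) => D w) h
  simpa [Derivation.commutator_apply, sub_eq_zero] using this

theorem osc_commute_neg (i i' : ι) {n n' : ℤ} (h : n < 0) (h' : n' < 0) :
    Commute (osc i n) (osc i' n') := by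
  ext1
  simp [osc, h, h', LinearMap.ext_iff, mul_left_comm]

theorem osc_commute_nonneg (i i' : ι) {n n' : ℤ} (h : 0 ≤ n) (h' : 0 ≤ n') :
    Commute (osc i n) (osc i' n') := by
  have hc : Commute (MvPolynomial.pderiv (i, (n - 1).toNat)).toLinearMap
      (MvPolynomial.pderiv (R := ℂ) (i', (n' - 1).toNat)).toLinearMap :=
    LinearMap.ext fun w => pderiv_comm _ _ w
  rw [osc, osc, if_neg h.not_gt, if_neg h'.not_gt]
  exact (hc.smul_left _).smul_right _

theorem osc_mixed (i i' : ι) {m n : ℤ} (hm : 0 ≤ m) (hn : n < 0) [Decidable (i = i' ∧ m + n = 0)] :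
    osc i m * osc i' n - osc i' n * osc i m =
      if i = i' ∧ m + n = 0 then (m : ℂ) • 1 else 0 := by
  classical
  refine LinearMap.ext fun w => ?_
  have key : (osc i m * osc i' n - osc i' n * osc i m) w =
      (m : ℂ) • (MvPolynomial.pderiv (i, (m - 1).toNat)
        (MvPolynomial.X (R := ℂ) (i', (-n - 1).toNat)) * w) := by
    rw [osc, osc, if_neg hm.not_gt, if_pos hn]
    simp only [LinearMap.sub_apply, Module.End.mul_apply, LinearMap.smul_apply,
      LinearMap.mulLeft_apply, Derivation.coeFn_coe, Derivation.leibniz, smul_eq_mul,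
      mul_smul_comm, smul_add]
    rw [add_sub_cancel_left, mul_comm w]
  rw [key]
  split_ifs with h
  · obtain ⟨rfl, h⟩ := h
    obtain rfl : n = -m := by omega
    simp
  · rcases eq_or_lt_of_le hm with rfl | hm'
    · simp
    · rw [MvPolynomial.pderiv_X_of_ne, zero_mul, smul_zero, LinearMap.zero_apply]
      intro hc
      simp only [Prod.mk.injEq] at hc
      exact h ⟨hc.1.symm, by omega⟩

open Classical in
/-- The Heisenberg relations `[h_i(m), h_{i'}(n)] = (h_i, h_{i'}) m δ_{m+n,0}`. -/
theorem osc_commutator (i i' : ι) (m n : ℤ) :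
    osc i m * osc i' n - osc i' n * osc i m =
      if i = i' ∧ m + n = 0 then (m : ℂ) • 1 else 0 := by
  rcases lt_or_ge m 0 with hm | hm <;> rcases lt_or_ge n 0 with hn | hn
  · rw [if_neg (by omega), sub_eq_zero]
    exact osc_commute_neg i i' hm hn
  · rw [← neg_sub, osc_mixed i' i hn hm]
    by_cases h : i = i' ∧ m + n = 0
    · rw [if_pos h, if_pos ⟨h.1.symm, by omega⟩]
      obtain rfl : m = -n := by omega
      rw [Int.cast_neg]
      exact (neg_smul _ _).symm
    · rw [if_neg h, if_neg fun h' => h ⟨h'.1.symm, by omega⟩, neg_zero]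
  · exact osc_mixed i i' hm hn
  · rw [sub_eq_zero.mpr (osc_commute_nonneg i i' hm hn)]
    split_ifs with h
    · obtain rfl : m = 0 := by omega
      simp
    · rfl

/-- `h_i(n) 𝟏 = 0` for `n ≥ 0`. -/
theorem osc_vacuum (i : ι) {n : ℤ} (h : 0 ≤ n) : osc i n 1 = 0 := by
  simp [osc, h.not_gt]

/-- For each `w`, the operators `h_i(n)` with `n` large annihilate `w`. -/
theorem exists_osc_bound (w : Fock ι) :
    ∃ N : ℤ, 0 ≤ N ∧ ∀ (i : ι) (n : ℤ), N < n → osc i n w = 0 := by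
  classical
  refine ⟨((w.vars.sup Prod.snd + 1 : ℕ) : ℤ), by positivity, fun i n hn => ?_⟩
  have hn0 : ¬ n < 0 := by omega
  have : (i, (n - 1).toNat) ∉ w.vars := by
    intro hm
    have := Finset.le_sup (f := Prod.snd) hm
    simp only at this
    omega
  rw [osc, if_neg hn0, LinearMap.smul_apply]
  exact (congrArg _ (MvPolynomial.pderiv_eq_zero_of_notMem_vars this)).trans (smul_zero _)

section Fields

variable {E : Type*} [Fintype E]

theorem pairwise_neg (a : E → ι × ℕ) (j : E → ℤ) :
    ((Finset.univ.filter fun e => j e < 0 : Finset E) : Set E).Pairwise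
      (Function.onFun Commute fun e : E => osc (a e).1 (j e)) :=
  fun _ he _ he' _ => osc_commute_neg _ _ (by simpa using he) (by simpa using he')

theorem pairwise_nonneg (a : E → ι × ℕ) (j : E → ℤ) :
    ((Finset.univ.filter fun e => 0 ≤ j e : Finset E) : Set E).Pairwise
      (Function.onFun Commute fun e : E => osc (a e).1 (j e)) :=
  fun _ he _ he' _ => osc_commute_nonneg _ _ (by simpa using he) (by simpa using he')

/-- The normally ordered product of the operators `h_{i_e}(j_e)`, where `e` runs over a finite set
and `a e = (i_e, m_e)`: the operators with `j_e < 0` stand to the left. -/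
def normalOrdered (a : E → ι × ℕ) (j : E → ℤ) : Module.End ℂ (Fock ι) :=
  (Finset.univ.filter fun e => j e < 0).noncommProd (fun e => osc (a e).1 (j e))
      (pairwise_neg a j) *
    (Finset.univ.filter fun e => 0 ≤ j e).noncommProd (fun e => osc (a e).1 (j e))
      (pairwise_nonneg a j)

/-- The contribution of the exponents `j` to
`:∏_e (1/m_e!) (d/dz)^{m_e} h_{i_e}(z):`, where `h(z) = ∑ h(j) z^(-j-1)`, so that
`(1/m!) (d/dz)^m h(z) = ∑ binom(-j-1, m) h(j) z^(-j-1-m)`. -/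
def fieldTerm (a : E → ι × ℕ) (j : E → ℤ) : Module.End ℂ (Fock ι) :=
  (∏ e : E, ((Ring.choose (-j e - 1) (a e).2 : ℤ) : ℂ)) • normalOrdered a j

/-- The power of `z` that goes with the exponents `j`. -/
def zPower (a : E → ι × ℕ) (j : E → ℤ) : ℤ :=
  ∑ e : E, (-j e - 1 - ((a e).2 : ℤ))

theorem fieldTerm_eq_zero (a : E → ι × ℕ) (w : Fock ι) {N : ℤ} (hN0 : 0 ≤ N)
    (hN : ∀ (i : ι) (n : ℤ), N < n → osc i n w = 0) (j : E → ℤ)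
    (e : E) (he : N < j e) : fieldTerm a j w = 0 := by
  classical
  have hmem : e ∈ Finset.univ.filter fun e => 0 ≤ j e := by
    simp; omega
  rw [fieldTerm, normalOrdered,
    ← Finset.noncommProd_erase_mul _ hmem _ (pairwise_nonneg a j)]
  simp [hN _ _ he]

theorem fieldTerm_finite (a : E → ι × ℕ) (q : ℤ) (w : Fock ι) :
    (Function.support fun j : {j : E → ℤ // zPower a j = q} =>
      fieldTerm a j w).Finite := by
  classical
  obtain ⟨N, hN0, hN⟩ := exists_osc_bound w
  set c : ℤ := ∑ e : E, (-1 - ((a e).2 : ℤ)) - q with hc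
  refine Set.Finite.of_finite_image (f := Subtype.val)
    ((Set.finite_Icc (fun _ : E => c - Fintype.card E * N)
      (fun _ => N)).subset ?_) Subtype.val_injective.injOn
  rintro _ ⟨⟨j, hj⟩, hne, rfl⟩
  have hle : ∀ e, j e ≤ N := fun e => by
    by_contra hlt
    exact hne (fieldTerm_eq_zero a w hN0 hN j e (not_le.mp hlt))
  refine ⟨fun e => ?_, hle⟩
  have hsum : ∑ e, j e = c := by
    rw [hc, ← hj, zPower, ← Finset.sum_sub_distrib]
    exact Finset.sum_congr rfl fun _ _ => by ring
  have h1 : ∑ e' ∈ Finset.univ.erase e, j e' ≤ Fintype.card E * N := by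
    calc ∑ e' ∈ Finset.univ.erase e, j e' ≤ ∑ _e' ∈ Finset.univ.erase e, N :=
          Finset.sum_le_sum fun e' _ => hle e'
      _ ≤ ∑ _e' : E, N :=
          Finset.sum_le_sum_of_subset_of_nonneg (Finset.erase_subset _ _) fun _ _ _ => hN0
      _ = _ := by simp
  have h2 := Finset.add_sum_erase Finset.univ j (Finset.mem_univ e)
  show c - Fintype.card E * N ≤ j e
  linarith

/-- The coefficient of `z ^ q` in `Y(v, z)`, for
`v = ∏_e h_{i_e}(-m_e-1) 𝟏`. The sum is finite on each vector. -/
def fieldCoeff (a : E → ι × ℕ) (q : ℤ) : Module.End ℂ (Fock ι) where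
  toFun w := ∑ᶠ j : {j : E → ℤ // zPower a j = q}, fieldTerm a j w
  map_add' w w' := by
    simp only [map_add]
    exact finsum_add_distrib (fieldTerm_finite a q w) (fieldTerm_finite a q w')
  map_smul' c w := by
    simp only [map_smul, RingHom.id_apply]
    exact (smul_finsum c _).symm

theorem fieldCoeff_apply (a : E → ι × ℕ) (q : ℤ) (w : Fock ι) :
    fieldCoeff a q w = ∑ᶠ j : {j : E → ℤ // zPower a j = q}, fieldTerm a j w := rfl

theorem fieldCoeff_bddBelow (a : E → ι × ℕ) (w : Fock ι) :
    BddBelow (Function.support fun q => fieldCoeff a q w) := by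
  obtain ⟨N, hN0, hN⟩ := exists_osc_bound w
  refine ⟨∑ e : E, (-N - 1 - ((a e).2 : ℤ)), fun q hq => ?_⟩
  obtain ⟨⟨j, hj⟩, hne⟩ : ∃ j : {j : E → ℤ // zPower a j = q},
      fieldTerm a j w ≠ 0 := by
    by_contra! hall
    exact hq (finsum_eq_zero_of_forall_eq_zero hall)
  rw [← hj]
  refine Finset.sum_le_sum fun e _ => ?_
  have : j e ≤ N := by
    by_contra hlt
    exact hne (fieldTerm_eq_zero a w hN0 hN j e (not_le.mp hlt))
  linarith

end Fields

/-- The factors of the monomial with exponents `s`: each variable `(i, m)` is counted with its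
multiplicity. -/
abbrev Factors (s : ι × ℕ →₀ ℕ) : Type _ := Σ a : s.support, Fin (s a)

/-- The variable `(i_e, m_e)` of which the factor `e` is a copy. -/
def Factors.var {s : ι × ℕ →₀ ℕ} (e : Factors s) : ι × ℕ := e.1

/-- The vertex operators of `M(1)`: for a monomial
`v = h_{i_1}(-m_1-1) ⋯ h_{i_k}(-m_k-1) 𝟏`,
`Y(v, z) = :∏_e (1/m_e!) (d/dz)^{m_e} h_{i_e}(z):`, extended linearly. -/
def Y (ι : Type*) : Fock ι →ₗ[ℂ] VertexOperator ℂ (Fock ι) :=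
  (MvPolynomial.basisMonomials (ι × ℕ) ℂ).constr ℂ fun s =>
    VertexOperator.of_coeff (fieldCoeff (Factors.var (s := s)))
      (fieldCoeff_bddBelow (Factors.var (s := s)))

/-- The vector `h_i = h_i(-1) 𝟏` of `M(1)`. -/
def gen (i : ι) : Fock ι := MvPolynomial.X (i, 0)

/-- The map `f_i = β^i_1 - α^i_{-1}` on `M(1)` for the space with orthonormal basis
`α^1, …, α^n` (indices `Sum.inl i`), `β^1, …, β^n` (indices `Sum.inr i`). -/
def f {n : ℕ} (i : Fin n) : Module.End ℂ (Fock (Fin n ⊕ Fin n)) :=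
  VOA.mode (Y (Fin n ⊕ Fin n)) (gen (Sum.inr i)) 1 -
    VOA.mode (Y (Fin n ⊕ Fin n)) (gen (Sum.inl i)) (-1)

end Heisenberg

/-- The operator `∂_{x_i} - ζ_i` on `ℂ[ζ_1, …, ζ_n, x_1, …, x_n]`, where `ζ_i` is the variable
`Sum.inl i` and `x_i` is the variable `Sum.inr i`. -/
def imageOp {n : ℕ} (i : Fin n) : Module.End ℂ (MvPolynomial (Fin n ⊕ Fin n) ℂ) :=
  (MvPolynomial.pderiv (Sum.inr i)).toLinearMap -
    LinearMap.mulLeft ℂ (MvPolynomial.X (Sum.inl i))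

end

noncomputable section

namespace Heisenberg

open MvPolynomial

variable {ι : Type*}

/-! Everything happens modulo `C₂`. The quotient of `M(1)` by `C₂` is the polynomial algebra on `𝔥`,
realised by `zhuMap`. There `u_{-1} v` becomes the commutative product (`zhuMap_mode_neg_one`), and
`u_0 v` becomes `0` (`zhuMap_mode_eq_zero`). An iterated product of `v` along a word in `0, -1`
therefore maps to `0` or to a power of the image of `v`, and the all `-1` words realise every
positive power (`zhuMap_iterProd`, `zhuMap_iterProd_replicate`). So for a preimage of a subspace `U`
both vertex-algebra radicals are the preimages of those of `U`, and surjectivity lets their equality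
descend (`isMZ_comap_iff`).

The subspace in question is such a preimage: it contains the kernel `C₂` (`C2_eq_ker`), and `f_i`
induces `∂_{x_i} - ζ_i` on the quotient (`zhuMap_f`, `iSup_range_f_sup_C2`). -/

/-- The algebra map `M(1) → S(𝔥)` that kills `h_i(-m-1) 𝟏` for `m ≥ 1` and sends `h_i(-1) 𝟏`
to `h_i`. Its kernel is `C₂(M(1))`. -/
def zhuMap (ι : Type*) : Fock ι →ₐ[ℂ] MvPolynomial ι ℂ :=
  aeval fun a => if a.2 = 0 then X a.1 else 0

theorem zhuMap_X (a : ι × ℕ) : zhuMap ι (X a) = if a.2 = 0 then X a.1 else 0 := by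
  simp [zhuMap]

theorem zhuMap_surjective : Function.Surjective (zhuMap ι) := by
  have h : (zhuMap ι).comp (rename fun i => (i, 0)) = AlgHom.id ℂ _ := by
    ext i; simp [zhuMap_X]
  exact fun p => ⟨rename (fun i => (i, 0)) p, DFunLike.congr_fun h p⟩

theorem osc_neg_apply (i : ι) {n : ℤ} (h : n < 0) (w : Fock ι) :
    osc i n w = X (i, (-n - 1).toNat) * w := by
  simp [osc, h]

theorem osc_zero (i : ι) : osc i 0 = 0 := by
  simp [osc]

/-! ### Coefficients of normally ordered products modulo `C₂` -/

section Fields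

variable {E : Type*} [Fintype E]

theorem zhuMap_normalOrdered_eq_zero (a : E → ι × ℕ) (j : E → ℤ) (w : Fock ι) (e : E)
    (he : j e < -1) : zhuMap ι (normalOrdered a j w) = 0 := by
  classical
  have hmem : e ∈ Finset.univ.filter fun e => j e < 0 := by
    simp; omega
  rw [normalOrdered, ← Finset.mul_noncommProd_erase _ hmem _ (pairwise_neg a j),
    Module.End.mul_apply, Module.End.mul_apply, osc_neg_apply _ (by omega), map_mul, zhuMap_X,
    if_neg (by simp only; omega), zero_mul]

theorem normalOrdered_eq_zero (a : E → ι × ℕ) (j : E → ℤ) (e : E) (he : j e = 0) :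
    normalOrdered a j = 0 := by
  classical
  have hmem : e ∈ Finset.univ.filter fun e => 0 ≤ j e := by
    simp; omega
  rw [normalOrdered, ← Finset.mul_noncommProd_erase _ hmem _ (pairwise_nonneg a j), he, osc_zero,
    zero_mul, mul_zero]

/-- Creation operators are multiplications, so their product is the image under `Algebra.lmul` of a
product of variables. -/
theorem normalOrdered_of_neg (a : E → ι × ℕ) (j : E → ℤ) (h : ∀ e, j e < 0) (w : Fock ι) :
    normalOrdered a j w = (∏ e, X ((a e).1, (-j e - 1).toNat)) * w := by
  classical
  have h₁ : (Finset.univ.filter fun e => j e < 0) = Finset.univ := by simp [h]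
  have h₂ : (Finset.univ.filter fun e => 0 ≤ j e) = ∅ := by simp [h]
  have key : (Finset.univ.filter fun e => j e < 0).noncommProd (fun e => osc (a e).1 (j e))
      (pairwise_neg a j) = Algebra.lmul ℂ (Fock ι) (∏ e, X ((a e).1, (-j e - 1).toNat)) := by
    refine (Finset.noncommProd_congr
      (g := fun e => Algebra.lmul ℂ (Fock ι) (X ((a e).1, (-j e - 1).toNat)))
      h₁ (fun e _ => LinearMap.ext fun w => ?_) _).trans ?_
    · simp [osc_neg_apply _ (h e)]
    · exact (Finset.map_noncommProd _ _ (fun _ _ _ _ _ => Commute.all _ _) _).symm.trans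
        (congrArg _ (Finset.noncommProd_eq_prod _ _))
  have key₂ : (Finset.univ.filter fun e => 0 ≤ j e).noncommProd (fun e => osc (a e).1 (j e))
      (pairwise_nonneg a j) = 1 :=
    (Finset.noncommProd_congr h₂ (fun _ _ => rfl) _).trans (Finset.noncommProd_empty _ _)
  rw [normalOrdered, key, key₂, mul_one]
  rfl

theorem choose_eq_zero_of_lt {j : ℤ} {m : ℕ} (hj : j < 0) (h : -j - 1 < m) :
    Ring.choose (-j - 1) m = 0 := by
  obtain ⟨k, hk⟩ := Int.eq_ofNat_of_zero_le (a := -j - 1) (by omega)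
  rw [hk, Ring.choose_natCast, Nat.choose_eq_zero_of_lt (by omega), Nat.cast_zero]

/-- The terms of `Y(v, z)` with nonzero image under `zhuMap` and a power of `z` at least `-1`
involve no annihilation operator and no derivative of a field. -/
theorem eq_of_zhuMap_fieldTerm_ne_zero (a : E → ι × ℕ) (j : E → ℤ) (w : Fock ι)
    (hq : -1 ≤ zPower a j) (h : zhuMap ι (fieldTerm a j w) ≠ 0) (e : E) :
    j e = -1 ∧ (a e).2 = 0 := by
  classical
  have hN : zhuMap ι (normalOrdered a j w) ≠ 0 := by
    intro h0
    simp [fieldTerm, h0] at h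
  have hC : ∀ e, Ring.choose (-j e - 1) (a e).2 ≠ 0 := by
    intro e h0
    refine h ?_
    rw [fieldTerm, Finset.prod_eq_zero (Finset.mem_univ e) (by rw [h0, Int.cast_zero])]
    simp
  have h₁ : ∀ e, -1 ≤ j e := fun e => by
    by_contra hlt
    exact hN (zhuMap_normalOrdered_eq_zero a j w e (by omega))
  have h₂ : ∀ e, j e ≠ 0 := fun e h0 => hN (by simp [normalOrdered_eq_zero a j e h0])
  have h₃ : ∀ e, j e < 0 → j e = -1 ∧ (a e).2 = 0 := fun e he => by
    have hj : j e = -1 := by have := h₁ e; omega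
    refine ⟨hj, ?_⟩
    by_contra hm
    exact hC e (choose_eq_zero_of_lt he (by omega))
  refine h₃ e ?_
  -- A factor with `j e ≥ 1` contributes at most `-2` to the power of `z`, and no other factor
  -- contributes a positive amount; this contradicts the bound `-1`.
  by_contra hpos
  have hle : zPower a j ≤ -j e - 1 - ((a e).2 : ℤ) := by
    rw [zPower, ← Finset.add_sum_erase _ _ (Finset.mem_univ e)]
    refine add_le_of_nonpos_right (Finset.sum_nonpos fun e' _ => ?_)
    rcases lt_or_ge (j e') 0 with h' | h'
    · have := h₃ e' h'
      omega
    · omega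
  have := h₂ e
  omega

theorem zhuMap_fieldCoeff (a : E → ι × ℕ) (q : ℤ) (w : Fock ι) :
    zhuMap ι (fieldCoeff a q w) =
      ∑ᶠ j : {j : E → ℤ // zPower a j = q}, zhuMap ι (fieldTerm a j w) :=
  map_finsum _ (fieldTerm_finite a q w)

theorem zhuMap_fieldCoeff_eq_zero (a : E → ι × ℕ) {q : ℤ} (hq : -1 ≤ q) (hq0 : q ≠ 0)
    (w : Fock ι) : zhuMap ι (fieldCoeff a q w) = 0 := by
  rw [zhuMap_fieldCoeff]
  refine finsum_eq_zero_of_forall_eq_zero fun ⟨j, hj⟩ => ?_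
  by_contra h
  have := eq_of_zhuMap_fieldTerm_ne_zero a j w (hj ▸ hq) h
  refine hq0 (hj ▸ Finset.sum_eq_zero fun e _ => ?_)
  have := this e
  omega

theorem zhuMap_fieldCoeff_zero (a : E → ι × ℕ) (w : Fock ι) :
    zhuMap ι (fieldCoeff a 0 w) = zhuMap ι (∏ e, X (a e)) * zhuMap ι w := by
  rw [zhuMap_fieldCoeff]
  -- The exponent `-1 - m_e`, rather than `-1`, gives power `0` for every `a`; if some `m_e > 0`,
  -- both sides of the claim vanish.
  have hj₀ : zPower a (fun e => -1 - ((a e).2 : ℤ)) = 0 :=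
    Finset.sum_eq_zero fun e _ => by ring
  rw [finsum_eq_single _ ⟨_, hj₀⟩]
  · rw [fieldTerm, LinearMap.smul_apply, normalOrdered_of_neg _ _ (fun e => by simp only; omega)]
    simp [Ring.choose_natCast]
  · rintro ⟨j, hj⟩ hne
    by_contra h
    have := eq_of_zhuMap_fieldTerm_ne_zero a j w (by omega) h
    refine hne (Subtype.ext (funext fun e => ?_))
    have := this e
    simp only
    omega

theorem normalOrdered_of_unique [Unique E] (a : E → ι × ℕ) (j : E → ℤ) :
    normalOrdered a j = osc (a default).1 (j default) := by
  have hempty : ∀ (s : Finset E) (comm), s = ∅ →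
      s.noncommProd (fun e => osc (a e).1 (j e)) comm = 1 := by
    rintro s comm rfl
    simp
  have hsingle : ∀ (s : Finset E) (comm), s = {default} →
      s.noncommProd (fun e => osc (a e).1 (j e)) comm = osc (a default).1 (j default) := by
    rintro s comm rfl
    simp
  rw [normalOrdered]
  rcases lt_or_ge (j default) 0 with h | h
  · rw [hsingle _ _ (by ext e; simp [Unique.eq_default e, h]),
      hempty _ _ (by ext e; simp [Unique.eq_default e, h]), mul_one]
  · rw [hempty _ _ (by ext e; simp [Unique.eq_default e, h]),
      hsingle _ _ (by ext e; simp [Unique.eq_default e, h]), one_mul]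

/-- With one factor, the power of `z` determines the exponent. -/
theorem fieldCoeff_of_unique [Unique E] (a : E → ι × ℕ) (q : ℤ) :
    fieldCoeff a q = ((Ring.choose (q + (a default).2) (a default).2 : ℤ) : ℂ) •
      osc (a default).1 (-q - 1 - (a default).2) := by
  refine LinearMap.ext fun w => ?_
  have hj : zPower a (fun _ => -q - 1 - ((a default).2 : ℤ)) = q := by
    rw [zPower, Fintype.sum_unique]
    ring
  rw [fieldCoeff_apply, finsum_eq_single _ ⟨_, hj⟩]
  · rw [fieldTerm, normalOrdered_of_unique, Fintype.prod_unique]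
    congr 4
    ring
  · rintro ⟨j, hj'⟩ hne
    refine absurd (Subtype.ext (funext fun e => ?_)) hne
    rw [zPower, Fintype.sum_unique] at hj'
    rw [Unique.eq_default e]
    simp only
    omega

end Fields

/-! ### Modes of vectors of `M(1)` -/

theorem prod_factors (s : ι × ℕ →₀ ℕ) :
    ∏ e : Factors s, (X e.var : Fock ι) = monomial s 1 := by
  rw [Fintype.prod_sigma, monomial_eq, C_1, one_mul, Finsupp.prod,
    ← Finset.prod_coe_sort s.support fun a => (X a : Fock ι) ^ s a]
  simp [Factors.var]

theorem mode_monomial (s : ι × ℕ →₀ ℕ) (n : ℤ) :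
    VOA.mode (Y ι) (monomial s 1) n = fieldCoeff (Factors.var (s := s)) (-n - 1) := by
  have h : Y ι (monomial s 1) = VertexOperator.of_coeff (fieldCoeff (Factors.var (s := s)))
      (fieldCoeff_bddBelow (Factors.var (s := s))) := by
    rw [Y]
    simpa using (basisMonomials (ι × ℕ) ℂ).constr_basis ℂ (fun s =>
      VertexOperator.of_coeff (fieldCoeff (Factors.var (s := s)))
        (fieldCoeff_bddBelow (Factors.var (s := s)))) s
  rw [VOA.mode, h, VertexOperator.ncoeff_of_coeff]

theorem mode_add (u v : Fock ι) (n : ℤ) :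
    VOA.mode (Y ι) (u + v) n = VOA.mode (Y ι) u n + VOA.mode (Y ι) v n := by
  simp [VOA.mode]

theorem mode_smul (c : ℂ) (u : Fock ι) (n : ℤ) :
    VOA.mode (Y ι) (c • u) n = c • VOA.mode (Y ι) u n := by
  simp [VOA.mode]

theorem zhuMap_mode_eq_zero (u w : Fock ι) {n : ℤ} (hn : n ≤ 0) (hn1 : n ≠ -1) :
    zhuMap ι (VOA.mode (Y ι) u n w) = 0 := by
  induction u using MvPolynomial.induction_on' with
  | monomial s c =>
    rw [← mul_one c, ← smul_eq_mul, ← smul_monomial, mode_smul, mode_monomial,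
      LinearMap.smul_apply, map_smul, zhuMap_fieldCoeff_eq_zero _ (by omega) (by omega), smul_zero]
  | add p q hp hq => rw [mode_add, LinearMap.add_apply, map_add, hp, hq, add_zero]

theorem zhuMap_mode_neg_one (u w : Fock ι) :
    zhuMap ι (VOA.mode (Y ι) u (-1) w) = zhuMap ι u * zhuMap ι w := by
  induction u using MvPolynomial.induction_on' with
  | monomial s c =>
    rw [← mul_one c, ← smul_eq_mul, ← smul_monomial, mode_smul, mode_monomial,
      LinearMap.smul_apply, map_smul, map_smul, neg_neg, sub_self, zhuMap_fieldCoeff_zero,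
      prod_factors, smul_mul_assoc]
  | add p q hp hq => rw [mode_add, LinearMap.add_apply, map_add, hp, hq, map_add, add_mul]

instance uniqueFactorsSingle (a : ι × ℕ) : Unique (Factors (Finsupp.single a 1)) where
  default := ⟨⟨a, by simp⟩, ⟨0, by simp⟩⟩
  uniq := by
    rintro ⟨⟨b, hb⟩, k⟩
    obtain rfl : b = a := by simpa using hb
    have : Subsingleton (Fin (Finsupp.single b 1 b)) := by
      rw [Finsupp.single_eq_same]; infer_instance
    exact congrArg _ (Subsingleton.elim _ _)

theorem mode_X (a : ι × ℕ) (n : ℤ) : VOA.mode (Y ι) (X a) n =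
    ((Ring.choose (-n - 1 + a.2) a.2 : ℤ) : ℂ) • osc a.1 (n - a.2) := by
  rw [X, mode_monomial, fieldCoeff_of_unique]
  change ((Ring.choose (-n - 1 + a.2) a.2 : ℤ) : ℂ) • osc a.1 (-(-n - 1) - 1 - a.2) = _
  congr 2
  ring

/-! ### The subspace as a preimage under `zhuMap` -/

/-- `C₂(M(1))` is the kernel of `zhuMap`. -/
theorem C2_eq_ker : VOA.C2 (Y ι) = LinearMap.ker (zhuMap ι).toLinearMap := by
  apply le_antisymm
  · refine Submodule.span_le.2 ?_
    rintro _ ⟨u, v, rfl⟩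
    exact zhuMap_mode_eq_zero u v (by norm_num) (by norm_num)
  · have hX : ∀ (i : ι) (m : ℕ) (w : Fock ι), X (i, m + 1) * w ∈ VOA.C2 (Y ι) := fun i m w => by
      -- The factor `m + 1` is the binomial coefficient from the `m`-th divided derivative, and it
      -- is invertible in `ℂ`.
      have h : VOA.mode (Y ι) (X (i, m)) (-2) w = ((m + 1 : ℕ) : ℂ) • (X (i, m + 1) * w) := by
        have h₁ : -(-2 : ℤ) - 1 + (m : ℕ) = ((m + 1 : ℕ) : ℤ) := by push_cast; ring
        have h₂ : (-(-2 - (m : ℤ)) - 1).toNat = m + 1 := by omega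
        simp only [mode_X]
        rw [LinearMap.smul_apply, osc_neg_apply _ (by omega), h₁, h₂, Ring.choose_natCast]
        simp
      have h0 : ((m + 1 : ℕ) : ℂ) ≠ 0 := by exact_mod_cast m.succ_ne_zero
      rw [← inv_smul_smul₀ h0 (X (i, m + 1) * w), ← h]
      exact Submodule.smul_mem _ _ (Submodule.subset_span ⟨_, _, rfl⟩)
    -- The `rename` is a section of `zhuMap`. The free multiplier `w` absorbs a factor `h_i(-1)` in
    -- the induction; the end uses `w = 1`.
    have key : ∀ u w : Fock ι,
        (u - rename (fun i => (i, 0)) (zhuMap ι u)) * w ∈ VOA.C2 (Y ι) := fun u => by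
      induction u using MvPolynomial.induction_on with
      | C c => simp [zhuMap]
      | add p q hp hq =>
        intro w
        have := add_mem (hp w) (hq w)
        rw [← add_mul] at this
        convert this using 2
        simp only [map_add]
        ring
      | mul_X p a hp =>
        intro w
        obtain ⟨i, _ | m⟩ := a
        · have := hp (X (i, 0) * w)
          rw [← mul_assoc, sub_mul] at this
          simpa [zhuMap_X] using this
        · have := hX i m (p * w)
          rw [mul_left_comm, ← mul_assoc] at this
          simpa [zhuMap_X] using this
    intro u hu
    simpa [show zhuMap ι u = 0 from hu] using key u 1

/-- The variables killed by `zhuMap` are constants for this derivation. -/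
theorem zhuMap_pderiv (i : ι) (w : Fock ι) :
    zhuMap ι (pderiv (i, 0) w) = pderiv i (zhuMap ι w) := by
  classical
  induction w using MvPolynomial.induction_on with
  | C c => simp [zhuMap]
  | add p q hp hq => simp only [map_add, hp, hq]
  | mul_X p a hp =>
    obtain ⟨i', m⟩ := a
    have hX : zhuMap ι (pderiv (i, 0) (X (i', m))) = pderiv i (zhuMap ι (X (i', m))) := by
      rw [zhuMap_X, pderiv_X]
      rcases m with _ | m
      · by_cases h : i' = i <;> simp [pderiv_X, h]
      · simp
    simp only [Derivation.leibniz, smul_eq_mul, map_add, map_mul, hp, hX]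

/-- The mode `β^i_1` is exactly the derivative in the variable `β^i(-1) 𝟏`, which survives in the
quotient. -/
theorem zhuMap_f {n : ℕ} (i : Fin n) (w : Fock (Fin n ⊕ Fin n)) :
    zhuMap _ (f i w) = imageOp i (zhuMap _ w) := by
  rw [f, imageOp, LinearMap.sub_apply, map_sub, zhuMap_mode_neg_one, gen, gen, mode_X]
  simp [osc, zhuMap_X, zhuMap_pderiv]

/-- Adding the kernel of a map to `W` gives the preimage of the image of `W`; surjectivity of
`zhuMap` makes the image of `range f_i` all of `range (imageOp i)`. -/
theorem iSup_range_f_sup_C2 {n : ℕ} {κ : Type*} (σ : κ → Fin n) :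
    (⨆ i, LinearMap.range (f (σ i))) ⊔ VOA.C2 (Y (Fin n ⊕ Fin n)) =
      (⨆ i, LinearMap.range (imageOp (σ i))).comap (zhuMap (Fin n ⊕ Fin n)).toLinearMap := by
  have hs : LinearMap.range (zhuMap (Fin n ⊕ Fin n)).toLinearMap = ⊤ :=
    LinearMap.range_eq_top.2 zhuMap_surjective
  have h : ∀ i : Fin n, (zhuMap (Fin n ⊕ Fin n)).toLinearMap ∘ₗ f i =
      imageOp i ∘ₗ (zhuMap (Fin n ⊕ Fin n)).toLinearMap :=
    fun i => LinearMap.ext fun w => zhuMap_f i w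
  rw [C2_eq_ker, ← Submodule.comap_map_eq, Submodule.map_iSup]
  congr 2
  funext i
  rw [← LinearMap.range_comp, h, LinearMap.range_comp_of_range_eq_top _ hs]

/-! ### Radicals of preimages -/

theorem zhuMap_iterProd_replicate (v : Fock ι) (t : ℕ) :
    zhuMap ι (VOA.iterProd (Y ι) v (List.replicate t (-1))) = zhuMap ι v ^ (t + 1) := by
  induction t with
  | zero => simp [VOA.iterProd]
  | succ t ih =>
    rw [List.replicate_succ, VOA.iterProd, List.foldr_cons, zhuMap_mode_neg_one, pow_succ', ← ih]
    rfl

theorem isWord_replicate (t : ℕ) : VOA.IsWord (List.replicate t (-1)) :=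
  fun _ h => Or.inr (List.eq_of_mem_replicate h)

/-- Modulo `C₂`, the iterated products of `v` are `0` or powers of `v`. -/
theorem zhuMap_iterProd (v : Fock ι) {ns : List ℤ} (h : VOA.IsWord ns) :
    zhuMap ι (VOA.iterProd (Y ι) v ns) = 0 ∨
      zhuMap ι (VOA.iterProd (Y ι) v ns) = zhuMap ι v ^ (ns.length + 1) := by
  induction ns with
  | nil => simp [VOA.iterProd]
  | cons m ns ih =>
    rw [VOA.iterProd, List.foldr_cons]
    rcases h m (by simp) with rfl | rfl
    · exact Or.inl (zhuMap_mode_eq_zero _ _ le_rfl (by norm_num))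
    · rw [zhuMap_mode_neg_one, List.length_cons, pow_succ']
      refine (ih fun k hk => h k (by simp [hk])).imp (fun h => ?_) (fun h => ?_)
      · exact mul_eq_zero_of_right _ h
      · exact congrArg _ h

theorem radical_comap (U : Submodule ℂ (MvPolynomial ι ℂ)) :
    VOA.radical (Y ι) (U.comap (zhuMap ι).toLinearMap) =
      zhuMap ι ⁻¹' MathieuZhao.radical U := by
  ext v
  constructor
  · rintro ⟨m, hm⟩
    -- A word of length `t` gives the power `t + 1`, hence the shift.
    refine ⟨m + 1, by omega, fun t ht => ?_⟩
    obtain ⟨t, rfl⟩ : ∃ t', t = t' + 1 := ⟨t - 1, by omega⟩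
    rw [← zhuMap_iterProd_replicate]
    exact hm _ (by simp; omega) (isWord_replicate t)
  · rintro ⟨m, -, hm⟩
    refine ⟨m, fun ns hns hw => ?_⟩
    change zhuMap ι _ ∈ U
    rcases zhuMap_iterProd v hw with h | h <;> rw [h]
    exacts [zero_mem _, hm _ (by omega)]

theorem strongRadical_comap (U : Submodule ℂ (MvPolynomial ι ℂ)) :
    VOA.strongRadical (Y ι) (U.comap (zhuMap ι).toLinearMap) =
      zhuMap ι ⁻¹' MathieuZhao.strongRadical U := by
  ext v
  constructor
  · rintro ⟨hv, -⟩ b c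
    -- By commutativity the two-sided multiplier is the single element `b * c`, so the left
    -- condition with `s = -1` suffices.
    obtain ⟨b', hb'⟩ := zhuMap_surjective (b * c)
    obtain ⟨m, hm⟩ := hv b'
    refine ⟨m + 1, by omega, fun t ht => ?_⟩
    obtain ⟨t, rfl⟩ : ∃ t', t = t' + 1 := ⟨t - 1, by omega⟩
    rw [mul_right_comm, ← hb', ← zhuMap_iterProd_replicate, ← zhuMap_mode_neg_one]
    exact hm _ (by simp; omega) (isWord_replicate t) _ (Or.inr rfl)
  · intro hv
    -- This serves the left and right conditions alike: for `s = -1` they agree modulo `C₂`, and for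
    -- `s = 0` the image is `0`.
    have key : ∀ b : Fock ι, ∃ m : ℕ, ∀ ns : List ℤ, m ≤ ns.length → VOA.IsWord ns →
        zhuMap ι b * zhuMap ι (VOA.iterProd (Y ι) v ns) ∈ U := fun b => by
      obtain ⟨m, -, hm⟩ := hv (zhuMap ι b) 1
      refine ⟨m, fun ns hns hw => ?_⟩
      rcases zhuMap_iterProd v hw with h | h <;> rw [h]
      · simp
      · simpa using hm (ns.length + 1) (by omega)
    refine ⟨fun b => ?_, fun b => ?_⟩ <;> obtain ⟨m, hm⟩ := key b <;>
      refine ⟨m, fun ns hns hw s hs => ?_⟩ <;> change zhuMap ι _ ∈ U <;>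
      rcases hs with rfl | rfl
    · rw [zhuMap_mode_eq_zero _ _ le_rfl (by norm_num)]
      exact zero_mem _
    · rw [zhuMap_mode_neg_one]
      exact hm ns hns hw
    · rw [zhuMap_mode_eq_zero _ _ le_rfl (by norm_num)]
      exact zero_mem _
    · rw [zhuMap_mode_neg_one, mul_comm]
      exact hm ns hns hw

theorem isMZ_comap_iff (U : Submodule ℂ (MvPolynomial ι ℂ)) :
    VOA.IsMZ (Y ι) (U.comap (zhuMap ι).toLinearMap) ↔ MathieuZhao.IsMZ U := by
  rw [VOA.IsMZ, radical_comap, strongRadical_comap, MathieuZhao.IsMZ,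
    zhuMap_surjective.preimage_injective.eq_iff]

end Heisenberg

end

theorem mainTheorem3 (n k : ℕ) (hk : k ≤ n) :
    VOA.IsMZ (Heisenberg.Y (Fin n ⊕ Fin n))
        ((⨆ i : Fin k, LinearMap.range (Heisenberg.f (Fin.castLE hk i))) ⊔
          VOA.C2 (Heisenberg.Y (Fin n ⊕ Fin n))) ↔
      MathieuZhao.IsMZ (R := ℂ)
        (⨆ i : Fin k, LinearMap.range (imageOp (Fin.castLE hk i))) := by
  rw [Heisenberg.iSup_range_f_sup_C2, Heisenberg.isMZ_comap_iff]
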